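/- There is a continuum of agents whose valuations $\theta\in[0,1]$ for an indivisible good have a continuous distribution $F$ with support $[0,1]$. Each agent owns one unit and demands two. A designer announces a closed set $A\subseteq[0,1]$ of invited types and an incentive compatible direct mechanism $q:[0,1]\to\{-1,0,1\}$, $t:[0,1]\to\mathbb{R}$ with $\int_A q\,dF\le 0$; the net utility of type $\theta$ from it is $u^m(\theta)=\theta q(\theta)-t(\theta)$. Each agent then joins the marketplace, joins the search market, or joins neither (payoff $0$). The marketplace operates if exactly the invited types join it; otherwise it shuts down, and $u^m=0$. An agent in the search market is matched with probability $p\in[0,1]$ with a random agent there, and the two trade and split the surplus equally: if the measurable set of searching types is $D$ and $F(D)>0$, then $$u^d(\theta)=\frac{p}{F(D)}\left[\int_{\{x\in D:\,x>\theta\}}\frac{x-\theta}{2}\,dF(x)+\int_{\{x\in D:\,x<\theta\}}\frac{\theta-x}{2}\,dF(x)\right],$$ and $u^d=0$ if $F(D)=0$. Market choices are an equilibrium after an announcement if no agent gains by changing his choice (choosing the marketplace gives $u^m(\theta)$) and no pair of types gains by moving to the search market together; such a pair $\theta,\theta'$ would get $u^d(\theta),u^d(\theta')$ if $F(D)>0$,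 and $p|\theta-\theta'|/2$ each if $F(D)=0$. An equilibrium is an announcement together with equilibrium choices after it, such that the designer's profit ($\int_A t\,dF$ if the marketplace operates, $0$ if not) is maximal among all announcements and equilibrium choices following them. Theorem. Suppose that in an equilibrium both markets are active: the set of types in the marketplace has positive measure, and the measure of meetings $\frac p2F(D)$ in the search market is positive. Then the set $D$ of types in the search market is an interval, up to at most one indifferent type: there are $0\le l<u\le 1$ such that $D\subseteq(l,u)$, the set $(l,u)\setminus D$ has at most one element, and $u^m(\theta)=u^d(\theta)$ for $\theta\in(l,u)\setminus D$. Moreover the restriction to simple equilibria is without loss: there is an equilibrium with the same profit in which exactly the types in $[0,l]\cup[u,1]$ are invited and join the marketplace, and exactly the types in $(l,u)$ join the search market. -/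

import Mathlib

open Set MeasureTheory

noncomputable section

namespace MarketChoice

/-- What the designer announces: a closed set of invited types in `[0,1]`, together with a direct
mechanism. A type that reports `θ` receives `q θ ∈ {-1, 0, 1}` units of the indivisible good and
pays `t θ`. The mechanism is incentive compatible. Only the values of `q` and `t` on `[0,1]`
matter. -/
structure Announcement where
  invited : Set ℝ
  q : ℝ → ℝ
  t : ℝ → ℝ
  invited_subset : invited ⊆ Icc 0 1
  invited_closed : IsClosed invited
  q_mem : ∀ θ ∈ Icc (0 : ℝ) 1, q θ = -1 ∨ q θ = 0 ∨ q θ = 1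
  incentive_compatible : ∀ θ ∈ Icc (0 : ℝ) 1, ∀ r ∈ Icc (0 : ℝ) 1,
    θ * q r - t r ≤ θ * q θ - t θ

/-- The designer cannot sell more units to the invited types than she buys from them. -/
def Announcement.Feasible (F : Measure ℝ) (a : Announcement) : Prop :=
  ∫ θ in a.invited, a.q θ ∂F ≤ 0

/-- The market choices of the agents: the types joining the marketplace and the types joining the
search market. The remaining types of `[0,1]` join neither. -/
structure Profile where
  market : Set ℝ
  search : Set ℝ
  market_subset : market ⊆ Icc 0 1
  search_subset : search ⊆ Icc 0 1
  market_measurable : MeasurableSet market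
  search_measurable : MeasurableSet search
  disjoint : Disjoint market search

/-- Expected net payoff of type `θ` from search when the types in `D` are searching: with
probability `p` the agent meets a type drawn from `F` conditional on `D`, sells to a higher type or
buys from a lower one, and obtains half of the surplus. It is `0` when `D` has measure zero, since
then nobody is met (division by zero gives zero). -/
def searchPayoff (F : Measure ℝ) (p : ℝ) (D : Set ℝ) (θ : ℝ) : ℝ :=
  p / F.real D *
    ((∫ x in D ∩ Ioi θ, (x - θ) / 2 ∂F) + ∫ x in D ∩ Iio θ, (θ - x) / 2 ∂F)

/-- Payoff of type `θ` from search when `θ` and `θ'` move there together. If the search market has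
positive measure, the probability of meeting the co-deviator is zero. If it has measure zero, the
only possible partner is the co-deviator. -/
def pairSearchPayoff (F : Measure ℝ) (p : ℝ) (D : Set ℝ) (θ θ' : ℝ) : ℝ :=
  open Classical in
  if F D = 0 then p * (|θ - θ'| / 2) else searchPayoff F p D θ

/-- The marketplace operates if exactly the invited types join it and shuts down otherwise. -/
def Operates (a : Announcement) (s : Profile) : Prop := s.market = a.invited

/-- Net payoff of type `θ` from the marketplace. A single agent is negligible, so this is also what
`θ` would obtain by moving there (misreporting is not better, by incentive compatibility). -/
def marketPayoff (a : Announcement) (s : Profile) (θ : ℝ) : ℝ :=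
  open Classical in
  if Operates a s then θ * a.q θ - a.t θ else 0

/-- Payoff of type `θ` from its own market choice. -/
def payoff (F : Measure ℝ) (p : ℝ) (a : Announcement) (s : Profile) (θ : ℝ) : ℝ :=
  open Classical in
  if θ ∈ s.market then marketPayoff a s θ
  else if θ ∈ s.search then searchPayoff F p s.search θ
  else 0

/-- Equilibrium of the market choice game that follows an announcement: no type gains by choosing
another market or by staying out, and no two types both gain by moving to the search market
together. -/
structure IsContinuationEquilibrium (F : Measure ℝ) (p : ℝ) (a : Announcement) (s : Profile) :
    Prop where
  market_le : ∀ θ ∈ Icc (0 : ℝ) 1, marketPayoff a s θ ≤ payoff F p a s θ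
  search_le : ∀ θ ∈ Icc (0 : ℝ) 1, searchPayoff F p s.search θ ≤ payoff F p a s θ
  nonneg : ∀ θ ∈ Icc (0 : ℝ) 1, 0 ≤ payoff F p a s θ
  no_bilateral : ∀ θ ∈ Icc (0 : ℝ) 1, ∀ θ' ∈ Icc (0 : ℝ) 1,
    ¬ (payoff F p a s θ < pairSearchPayoff F p s.search θ θ' ∧
       payoff F p a s θ' < pairSearchPayoff F p s.search θ' θ)

/-- The designer's profit: total payments of the types in the marketplace, if it operates. -/
def profit (F : Measure ℝ) (a : Announcement) (s : Profile) : ℝ :=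
  open Classical in
  if Operates a s then ∫ θ in a.invited, a.t θ ∂F else 0

/-- Equilibrium: the agents' choices are an equilibrium after the announcement, and the designer
cannot obtain more profit from any feasible announcement and equilibrium choices following it. -/
structure IsEquilibrium (F : Measure ℝ) (p : ℝ) (a : Announcement) (s : Profile) : Prop where
  feasible : a.Feasible F
  continuation : IsContinuationEquilibrium F p a s
  optimal : ∀ (a' : Announcement) (s' : Profile), a'.Feasible F →
    IsContinuationEquilibrium F p a' s' → profit F a' s' ≤ profit F a s

/-- A positive measure of agents is in the marketplace. -/
def MarketplaceActive (F : Measure ℝ) (s : Profile) : Prop := 0 < F.real s.market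

/-- The measure of meetings `m * F(search)`, where `m = p / 2`, is positive. -/
def SearchActive (F : Measure ℝ) (p : ℝ) (s : Profile) : Prop := 0 < p / 2 * F.real s.search

end MarketChoice

end

/-! The payoff from search is `p / (2 F(D))` times the integral of `|x - θ|` over `D`. It is
positive for every type (no atoms), convex, and has slope at most `1/2`, while a trader's payoff in
the marketplace has slope `-1` or `1`. So nobody stays out, the sellers invited form an initial
segment with supremum `l`, the buyers a final segment with infimum `u`, and search takes place
between them.

Adding the participation constraints of a seller and a buyer and using the triangle inequality `|x -
l| + |x - u| ≥ u - l` bounds the price spread by `(1 - p/2)(u - l)`. The bound is attained when `(l,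
u)` searches (`exists_interval_equilibrium`). Buying more units than are sold, or paying invited
types that do not trade, only costs money; hence comparison with an interval announcement shows that
sellers and buyers are equally many and that the invited non-traders form a null set
(`exists_cutoffs`).

Two such non-traders would get the same constant market payoff, weakly above search; a searching
type between them would get at least that constant from search. This contradicts strict convexity of
the search payoff across a stretch where `D` has mass. -/

namespace MarketChoice

/-! ### Atomless distributions with full support -/

section Measure

variable {F : Measure ℝ} [IsProbabilityMeasure F]

theorem nullSingletonClass_of_continuous_cdf (hc : Continuous (ProbabilityTheory.cdf F)) : NullSingletonClass F := by
  refine ⟨fun x => ?_⟩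
  rw [← ProbabilityTheory.measure_cdf F, StieltjesFunction.measure_singleton]
  have : Function.leftLim (ProbabilityTheory.cdf F) x = ProbabilityTheory.cdf F x :=
    hc.continuousAt.continuousWithinAt.leftLim_eq
  simp [this]

theorem measureReal_unitInterval (hF : F.support = Icc (0 : ℝ) 1) : F.real (Icc 0 1) = 1 := by
  have h : F (Icc (0 : ℝ) 1)ᶜ = 0 := hF ▸ Measure.measure_compl_support
  have h2 := measureReal_add_measureReal_compl (μ := F) (measurableSet_Icc (a := (0 : ℝ)) (b := 1))
  simpa [measureReal_def, h] using h2

theorem measureReal_Ioo_pos (hF : F.support = Icc (0 : ℝ) 1) {x y : ℝ} (hx : 0 ≤ x) (hxy : x < y)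
    (hy : y ≤ 1) : 0 < F.real (Ioo x y) := by
  have hm : (x + y) / 2 ∈ F.support := by rw [hF]; constructor <;> linarith
  rw [Measure.mem_support_iff_forall] at hm
  exact ENNReal.toReal_pos
    (hm _ (Ioo_mem_nhds (by linarith) (by linarith))).ne' (measure_ne_top _ _)

theorem measureReal_Icc_zero (hF : F.support = Icc (0 : ℝ) 1) {x : ℝ} (hx : 0 ≤ x) :
    F.real (Icc 0 x) = ProbabilityTheory.cdf F x := by
  rw [ProbabilityTheory.cdf_eq_real]
  have h : F (Iio (0 : ℝ)) = 0 := by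
    refine measure_mono_null ?_ (hF ▸ Measure.measure_compl_support : F (Icc (0 : ℝ) 1)ᶜ = 0)
    intro y hy h; exact absurd h.1 (not_le.2 hy)
  have h2 : Iic x = Iio 0 ∪ Icc 0 x := (Iio_union_Icc_eq_Iic hx).symm
  rw [measureReal_def, measureReal_def, h2]
  congr 1
  refine le_antisymm (measure_mono subset_union_right) ?_
  exact (measure_union_le _ _).trans (by simp [h])

theorem measureReal_Icc_one [NullSingletonClass F] (hF : F.support = Icc (0 : ℝ) 1) {x : ℝ}
    (hx : 0 ≤ x) (hx1 : x ≤ 1) : F.real (Icc x 1) = 1 - ProbabilityTheory.cdf F x := by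
  have h1 := measureReal_unitInterval hF
  have h2 : Disjoint (Ico 0 x) (Icc x 1) :=
    Set.disjoint_left.2 fun y h h' => absurd h'.1 (not_le.2 h.2)
  rw [← Ico_union_Icc_eq_Icc hx hx1, measureReal_union h2 measurableSet_Icc,
    measureReal_congr Ico_ae_eq_Icc, measureReal_Icc_zero hF hx] at h1
  linarith

end Measure

/-! ### Convexity and Lipschitz bounds for the search payoff -/

section Search

variable {F : Measure ℝ} [IsProbabilityMeasure F] {p : ℝ} {D : Set ℝ}

theorem integrableOn_abs_sub (hD : D ⊆ Icc 0 1) (θ : ℝ) :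
    IntegrableOn (fun x => |x - θ|) D F :=
  ((by fun_prop : Continuous fun x : ℝ => |x - θ|).continuousOn.integrableOn_compact
    isCompact_Icc).mono_set hD

/-- Buyer and seller gains are both half the distance to the partner, so they merge into one
integral; convexity and the slope bounds are read off this form. -/
theorem searchPayoff_eq (hD : D ⊆ Icc 0 1) (θ : ℝ) :
    searchPayoff F p D θ = p / (2 * F.real D) * ∫ x in D, |x - θ| ∂F := by
  have key : ((∫ x in D ∩ Ioi θ, (x - θ) / 2 ∂F) + ∫ x in D ∩ Iio θ, (θ - x) / 2 ∂F)
      = ∫ x in D, |x - θ| / 2 ∂F := by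
    have hi (g : ℝ → ℝ) (hg : Continuous g) : IntegrableOn g D F :=
      (hg.continuousOn.integrableOn_compact isCompact_Icc).mono_set hD
    rw [← setIntegral_indicator measurableSet_Ioi, ← setIntegral_indicator measurableSet_Iio,
      ← integral_add ((hi _ (by fun_prop)).indicator measurableSet_Ioi)
        ((hi _ (by fun_prop)).indicator measurableSet_Iio)]
    congr 1
    ext x
    rcases lt_trichotomy x θ with h | h | h
    · simp [indicator, h, h.le, abs_of_neg (sub_neg.2 h)]
    · simp [h]
    · simp [indicator, h, h.le, abs_of_pos (sub_pos.2 h)]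
  rw [searchPayoff, key, integral_div]
  ring

theorem searchPayoff_nonneg (hp : 0 ≤ p) (hD : D ⊆ Icc 0 1) (θ : ℝ) :
    0 ≤ searchPayoff F p D θ := by
  rw [searchPayoff_eq hD]
  exact mul_nonneg (div_nonneg hp (by positivity)) (integral_nonneg fun _ => abs_nonneg _)

theorem searchPayoff_pos [NullSingletonClass F] (hp : 0 < p) (hD : D ⊆ Icc 0 1)
    (hFD : 0 < F.real D) (θ : ℝ) : 0 < searchPayoff F p D θ := by
  rw [searchPayoff_eq hD]
  refine mul_pos (by positivity) ?_
  rw [setIntegral_pos_iff_support_of_nonneg_ae (Filter.Eventually.of_forall fun _ => abs_nonneg _)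
    (integrableOn_abs_sub hD θ)]
  have h : Function.support (fun x : ℝ => |x - θ|) ∩ D = D \ {θ} := by
    ext x; simp [sub_eq_zero, and_comm]
  rw [h, measure_sdiff_null (measure_singleton θ)]
  exact (ENNReal.toReal_pos_iff.1 hFD).1

theorem searchPayoff_lipschitz (hp : 0 ≤ p) (hp1 : p ≤ 1)
    (hD : D ⊆ Icc 0 1) (hFD : 0 < F.real D) (θ θ' : ℝ) :
    searchPayoff F p D θ ≤ searchPayoff F p D θ' + |θ - θ'| / 2 := by
  rw [searchPayoff_eq hD, searchPayoff_eq hD]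
  have h : ∫ x in D, |x - θ| ∂F ≤ (∫ x in D, |x - θ'| ∂F) + F.real D * |θ - θ'| := by
    rw [← smul_eq_mul, ← setIntegral_const, ← integral_add (integrableOn_abs_sub hD θ')
      (integrable_const _)]
    refine integral_mono (integrableOn_abs_sub hD θ)
      ((integrableOn_abs_sub hD θ').add (integrable_const _)) fun x => ?_
    have := abs_sub_le x θ' θ
    rw [abs_sub_comm θ' θ] at this
    exact this
  calc p / (2 * F.real D) * ∫ x in D, |x - θ| ∂F
      ≤ p / (2 * F.real D) * ((∫ x in D, |x - θ'| ∂F) + F.real D * |θ - θ'|) := by gcongr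
    _ = p / (2 * F.real D) * (∫ x in D, |x - θ'| ∂F) + p * (|θ - θ'| / 2) := by
        field_simp
    _ ≤ _ := by
        have := abs_nonneg (θ - θ')
        gcongr
        nlinarith

/-- The triangle inequality integrated over `D`. It limits the price spread in the marketplace;
equality for an interval `D` is `searchPayoff_Ioo_add`. -/
theorem le_searchPayoff_add (hp : 0 ≤ p) (hD : D ⊆ Icc 0 1)
    (hFD : 0 < F.real D) (θ θ' : ℝ) :
    p / 2 * (θ' - θ) ≤ searchPayoff F p D θ + searchPayoff F p D θ' := by
  rw [searchPayoff_eq hD, searchPayoff_eq hD, ← mul_add,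
    ← integral_add (integrableOn_abs_sub hD θ) (integrableOn_abs_sub hD θ')]
  have h : F.real D * (θ' - θ) ≤ ∫ x in D, (|x - θ| + |x - θ'|) ∂F := by
    rw [← smul_eq_mul, ← setIntegral_const]
    refine integral_mono (integrable_const _)
      ((integrableOn_abs_sub hD θ).add (integrableOn_abs_sub hD θ')) fun x => ?_
    have h1 := le_abs_self (x - θ)
    have h2 := neg_abs_le (x - θ')
    change θ' - θ ≤ |x - θ| + |x - θ'|
    linarith
  calc p / 2 * (θ' - θ) = p / (2 * F.real D) * (F.real D * (θ' - θ)) := by field_simp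
    _ ≤ _ := by gcongr

theorem searchPayoff_Ioo_add {l u : ℝ} (hD : Ioo l u ⊆ Icc 0 1) (hFD : 0 < F.real (Ioo l u)) :
    searchPayoff F p (Ioo l u) l + searchPayoff F p (Ioo l u) u = p / 2 * (u - l) := by
  rw [searchPayoff_eq hD, searchPayoff_eq hD, ← mul_add,
    ← integral_add (integrableOn_abs_sub hD l) (integrableOn_abs_sub hD u)]
  have h : ∫ x in Ioo l u, (|x - l| + |x - u|) ∂F = F.real (Ioo l u) * (u - l) := by
    rw [← smul_eq_mul, ← setIntegral_const]
    refine setIntegral_congr_fun measurableSet_Ioo fun x hx => ?_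
    rw [abs_of_pos (sub_pos.2 hx.1), abs_of_neg (sub_neg.2 hx.2)]
    ring
  rw [h]
  field_simp

/-- For fixed `w` the distance `|w - z|` is convex in `z`, and lies strictly below its chord over
`[x, y]` when `w` is strictly between `x` and `y`; such `w` have positive mass in `D`. -/
theorem searchPayoff_lt_of_mem_Ioo (hp : 0 < p) (hD : D ⊆ Icc 0 1)
    {x y z c : ℝ} (hxy : 0 < F.real (D ∩ Ioo x y)) (hz : z ∈ Ioo x y)
    (hx : searchPayoff F p D x ≤ c) (hy : searchPayoff F p D y ≤ c) :
    searchPayoff F p D z < c := by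
  have hFD : 0 < F.real D := hxy.trans_le (measureReal_mono inter_subset_left)
  have hlt : x < y := hz.1.trans hz.2
  have key : (y - x) * ∫ w in D, |w - z| ∂F
      < (y - z) * (∫ w in D, |w - x| ∂F) + (z - x) * ∫ w in D, |w - y| ∂F := by
    have i1 := (integrableOn_abs_sub (F := F) hD x).const_mul (y - z)
    have i2 := (integrableOn_abs_sub (F := F) hD y).const_mul (z - x)
    have i3 := (integrableOn_abs_sub (F := F) hD z).const_mul (y - x)
    have i4 : IntegrableOn (fun w => (y - z) * |w - x| + (z - x) * |w - y|) D F := i1.add i2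
    rw [← integral_const_mul, ← integral_const_mul, ← integral_const_mul, ← integral_add i1 i2,
      ← sub_pos, ← integral_sub i4 i3]
    have hz1 := sub_pos.2 hz.1
    have hz2 := sub_pos.2 hz.2
    have hnn (w : ℝ) : 0 ≤ (y - z) * |w - x| + (z - x) * |w - y| - (y - x) * |w - z| := by
      have h1 : (y - x) * |w - z| = |(y - z) * (w - x) + (z - x) * (w - y)| := by
        conv_lhs => rw [← abs_of_pos (sub_pos.2 hlt), ← abs_mul]
        congr 1; ring
      have h2 := abs_add_le ((y - z) * (w - x)) ((z - x) * (w - y))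
      rw [abs_mul, abs_mul, abs_of_pos hz1, abs_of_pos hz2] at h2
      linarith
    rw [setIntegral_pos_iff_support_of_nonneg_ae (Filter.Eventually.of_forall hnn)
      (i4.sub i3)]
    refine (ENNReal.toReal_pos_iff.1 hxy).1.trans_le (measure_mono ?_)
    rintro w ⟨hwD, hw⟩
    refine ⟨?_, hwD⟩
    rw [Function.mem_support]
    refine ne_of_gt ?_
    have hw1 := sub_pos.2 hw.1
    have hw2 := sub_pos.2 hw.2
    have a1 := mul_pos hz2 hw1
    have a2 := mul_pos hz1 hw2
    -- Here `w - x` and `w - y` have opposite signs, so the triangle inequality is strict.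
    rw [abs_of_pos hw1, abs_of_neg (sub_neg.2 hw.2)]
    rcases abs_cases (w - z) with ⟨h, _⟩ | ⟨h, _⟩ <;> rw [h] <;> nlinarith
  rw [searchPayoff_eq hD] at *
  have hk : 0 < p / (2 * F.real D) := by positivity
  have h1 := mul_lt_mul_of_pos_left key hk
  have h2 := mul_le_mul_of_nonneg_left hx (sub_pos.2 hz.2).le
  have h3 := mul_le_mul_of_nonneg_left hy (sub_pos.2 hz.1).le
  refine lt_of_mul_lt_mul_left ?_ (sub_pos.2 hlt).le
  linarith

end Search

end MarketChoice

namespace MarketChoice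

/-! ### Simple equilibria with posted prices -/

section Simple

/-- The mechanism that buys at price `w` and sells at price `v`. -/
noncomputable def postedPrices (A : Set ℝ) (hA : A ⊆ Icc 0 1) (hAc : IsClosed A) (w v : ℝ)
    (hwv : w < v) : Announcement where
  invited := A
  q θ := if θ ≤ w then -1 else if v ≤ θ then 1 else 0
  t θ := if θ ≤ w then -w else if v ≤ θ then v else 0
  invited_subset := hA
  invited_closed := hAc
  q_mem θ _ := by split_ifs <;> simp
  incentive_compatible θ _ r _ := by
    split_ifs <;> linarith

/-- The profile in which the types in `(l, u)` search and the other types join the marketplace. -/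
def intervalProfile (l u : ℝ) (hl : 0 ≤ l) (hlu : l < u) (hu : u ≤ 1) : Profile where
  market := Icc 0 l ∪ Icc u 1
  search := Ioo l u
  market_subset := union_subset (Icc_subset_Icc_right (hlu.le.trans hu))
    (Icc_subset_Icc_left (hl.trans hlu.le))
  search_subset := Ioo_subset_Icc_self.trans (Icc_subset_Icc hl hu)
  market_measurable := measurableSet_Icc.union measurableSet_Icc
  search_measurable := measurableSet_Ioo
  disjoint := by
    rw [Set.disjoint_left]
    rintro x (h | h) h'
    · exact absurd h.2 (not_le.2 h'.1)
    · exact absurd h.1 (not_le.2 h'.2)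

variable {F : Measure ℝ} [IsProbabilityMeasure F] {p : ℝ}

/-- Prices `l + d l` and `u - d u` make the cutoff types indifferent, and the slope comparison sorts
all others. Equal masses on both sides clear the market, and the spread is `(1 - p/2)(u - l)`. -/
theorem exists_interval_equilibrium (hF : F.support = Icc (0 : ℝ) 1) (hp0 : 0 ≤ p) (hp1 : p ≤ 1)
    {l u : ℝ} (hl : 0 ≤ l) (hlu : l < u) (hu : u ≤ 1)
    (hbal : F.real (Icc 0 l) = F.real (Icc u 1)) :
    ∃ (a : Announcement) (s : Profile), a.Feasible F ∧ IsContinuationEquilibrium F p a s ∧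
      s.search = Ioo l u ∧ s.market = Icc 0 l ∪ Icc u 1 ∧ a.invited = Icc 0 l ∪ Icc u 1 ∧
      profit F a s = F.real (Icc u 1) * ((1 - p / 2) * (u - l)) := by
  set s := intervalProfile l u hl hlu hu with hsdef
  have hD : Ioo l u ⊆ Icc 0 1 := s.search_subset
  have hFD : 0 < F.real (Ioo l u) := measureReal_Ioo_pos hF hl hlu hu
  set d := searchPayoff F p (Ioo l u) with hd
  have hd0 (θ : ℝ) : 0 ≤ d θ := searchPayoff_nonneg hp0 hD θ
  have hdl (θ θ' : ℝ) : d θ ≤ d θ' + |θ - θ'| / 2 := searchPayoff_lipschitz hp0 hp1 hD hFD θ θ'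
  have hsum : d l + d u = p / 2 * (u - l) := searchPayoff_Ioo_add hD hFD
  have hgap : u - d u - (l + d l) = (1 - p / 2) * (u - l) := by linarith
  have hwv : l + d l < u - d u := by
    have : 0 < (1 - p / 2) * (u - l) := mul_pos (by linarith) (by linarith)
    linarith
  set a := postedPrices (Icc 0 l ∪ Icc u 1) s.market_subset
    (isClosed_Icc.union isClosed_Icc) (l + d l) (u - d u) hwv with ha
  have hop : Operates a s := rfl
  have hsearch : s.search = Ioo l u := rfl
  have hmarket : s.market = Icc 0 l ∪ Icc u 1 := rfl
  have hinv : a.invited = Icc 0 l ∪ Icc u 1 := rfl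
  have hql {θ : ℝ} (h : θ ≤ l) : a.q θ = -1 ∧ a.t θ = -(l + d l) := by
    have : θ ≤ l + d l := by linarith [hd0 l]
    exact ⟨if_pos this, if_pos this⟩
  have hqu {θ : ℝ} (h : u ≤ θ) : a.q θ = 1 ∧ a.t θ = u - d u := by
    have h1 : ¬ θ ≤ l + d l := by linarith [hd0 u]
    have h2 : u - d u ≤ θ := by linarith [hd0 u]
    exact ⟨(if_neg h1).trans (if_pos h2), (if_neg h1).trans (if_pos h2)⟩
  have hpay (θ : ℝ) (hθ : θ ∈ Icc (0 : ℝ) 1) : d θ ≤ payoff F p a s θ ∧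
      marketPayoff a s θ ≤ payoff F p a s θ := by
    unfold payoff marketPayoff
    rw [if_pos hop, hsearch, hmarket]
    by_cases h1 : θ ≤ l
    · rw [if_pos (show θ ∈ Icc 0 l ∪ Icc u 1 from Or.inl ⟨hθ.1, h1⟩), (hql h1).1, (hql h1).2]
      refine ⟨?_, le_rfl⟩
      have := hdl θ l
      rw [abs_of_nonpos (by linarith)] at this
      linarith
    by_cases h2 : u ≤ θ
    · rw [if_pos (show θ ∈ Icc 0 l ∪ Icc u 1 from Or.inr ⟨h2, hθ.2⟩), (hqu h2).1, (hqu h2).2]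
      refine ⟨?_, le_rfl⟩
      have := hdl θ u
      rw [abs_of_nonneg (by linarith)] at this
      linarith
    have h3 : θ ∉ Icc 0 l ∪ Icc u 1 := by rintro (h | h); exacts [h1 h.2, h2 h.1]
    push Not at h1 h2
    rw [if_neg h3, if_pos (show θ ∈ Ioo l u from ⟨h1, h2⟩)]
    refine ⟨le_rfl, ?_⟩
    have e1 := hdl l θ
    have e2 := hdl u θ
    rw [abs_of_nonpos (by linarith)] at e1
    rw [abs_of_nonneg (by linarith)] at e2
    -- A searching type may lie below the buying price or above the selling price; trading there
    -- still loses to search, since away from the cutoff the gain from trade falls at rate `1` and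
    -- the search payoff at rate at most `1/2`.
    change θ * (if θ ≤ l + d l then -1 else if u - d u ≤ θ then 1 else 0) -
      (if θ ≤ l + d l then -(l + d l) else if u - d u ≤ θ then u - d u else 0) ≤ d θ
    split_ifs
    · linarith
    · linarith
    · linarith [hd0 θ]
  have hint (f : ℝ → ℝ) (x y : ℝ) (h1 : ∀ θ ≤ l, f θ = x) (h2 : ∀ θ, u ≤ θ → f θ = y) :
      ∫ θ in a.invited, f θ ∂F = F.real (Icc u 1) * (x + y) := by
    have e1 : EqOn f (fun _ => x) (Icc 0 l) := fun θ h => h1 θ h.2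
    have e2 : EqOn f (fun _ => y) (Icc u 1) := fun θ h => h2 θ h.1
    rw [hinv, setIntegral_union _ measurableSet_Icc
      ((integrableOn_const (by finiteness)).congr_fun e1.symm measurableSet_Icc)
      ((integrableOn_const (by finiteness)).congr_fun e2.symm measurableSet_Icc),
      setIntegral_congr_fun measurableSet_Icc e1, setIntegral_congr_fun measurableSet_Icc e2,
      setIntegral_const, setIntegral_const, hbal, smul_eq_mul, smul_eq_mul]
    · ring
    · exact Set.disjoint_left.2 fun y h h' => absurd (h'.1.trans h.2) (not_le.2 hlu)
  refine ⟨a, s, ?_, ⟨fun θ h => (hpay θ h).2, fun θ h => (hpay θ h).1,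
    fun θ h => (hd0 θ).trans (hpay θ h).1, ?_⟩, rfl, rfl, rfl, ?_⟩
  · unfold Announcement.Feasible
    rw [hint a.q (-1) 1 (fun θ h => (hql h).1) fun θ h => (hqu h).1]
    simp
  · rintro θ hθ θ' - ⟨h, -⟩
    -- With positive mass searching, a joint deviation pays no more than an individual one.
    have hne : F s.search ≠ 0 := (ENNReal.toReal_pos_iff.1 hFD).1.ne'
    rw [pairSearchPayoff, if_neg hne] at h
    exact absurd (hpay θ hθ).1 (not_le.2 h)
  · rw [profit, if_pos hop,
      hint a.t (-(l + d l)) (u - d u) (fun θ h => (hql h).2) fun θ h => (hqu h).2, ← hgap]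
    ring

end Simple

end MarketChoice

namespace MarketChoice

/-! ### Incentive compatible mechanisms with three allocations -/

section Mechanism

variable (a : Announcement)

/-- The invited types that receive `k` units. -/
def Announcement.invitedWith (k : ℝ) : Set ℝ := {θ ∈ a.invited | a.q θ = k}

variable {a}

theorem Announcement.q_mono {θ θ' : ℝ} (h : θ ∈ Icc (0 : ℝ) 1) (h' : θ' ∈ Icc (0 : ℝ) 1)
    (hle : θ ≤ θ') : a.q θ ≤ a.q θ' := by
  rcases hle.eq_or_lt with rfl | hlt
  · exact le_rfl
  have h1 := a.incentive_compatible θ h θ' h'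
  have h2 := a.incentive_compatible θ' h' θ h
  by_contra! hq
  nlinarith

theorem Announcement.t_eq {θ θ' : ℝ} (h : θ ∈ Icc (0 : ℝ) 1) (h' : θ' ∈ Icc (0 : ℝ) 1)
    (hq : a.q θ = a.q θ') : a.t θ = a.t θ' := by
  have h1 := a.incentive_compatible θ h θ' h'
  have h2 := a.incentive_compatible θ' h' θ h
  rw [hq] at h1 h2
  linarith

/-- The predicate `P` carries a bound on the payments over to the constant `c`, which is arbitrary
when no invited type receives `k`. -/
theorem Announcement.exists_t_eq (k : ℝ) {P : ℝ → Prop} (hP : ∃ c, P c)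
    (h : ∀ θ ∈ a.invitedWith k, P (a.t θ)) : ∃ c, P c ∧ ∀ θ ∈ a.invitedWith k, a.t θ = c := by
  by_cases hne : (a.invitedWith k).Nonempty
  · obtain ⟨θ, hθ⟩ := hne
    exact ⟨a.t θ, h θ hθ, fun θ' hθ' => a.t_eq (a.invited_subset hθ'.1) (a.invited_subset hθ.1)
      (hθ'.2.trans hθ.2.symm)⟩
  · obtain ⟨c, hc⟩ := hP
    exact ⟨c, hc, fun θ hθ => absurd ⟨θ, hθ⟩ hne⟩

/-- Measurability of `q` is not assumed; its level sets in `[0,1]` are order-connected because `q`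
is monotone. -/
theorem Announcement.measurableSet_invitedWith {k : ℝ} : MeasurableSet (a.invitedWith k) := by
  have h : (Icc (0 : ℝ) 1 ∩ {θ | a.q θ = k}).OrdConnected := by
    refine ⟨fun x hx y hy z hz => ?_⟩
    have hz1 : z ∈ Icc (0 : ℝ) 1 := ⟨hx.1.1.trans hz.1, hz.2.trans hy.1.2⟩
    exact ⟨hz1, le_antisymm ((a.q_mono hz1 hy.1 hz.2).trans hy.2.le)
      (hx.2.ge.trans (a.q_mono hx.1 hz1 hz.1))⟩
  have h2 : a.invitedWith k = a.invited ∩ (Icc (0 : ℝ) 1 ∩ {θ | a.q θ = k}) := by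
    ext θ
    exact ⟨fun h => ⟨h.1, a.invited_subset h.1, h.2⟩, fun h => ⟨h.1, h.2.2⟩⟩
  rw [h2]
  exact a.invited_closed.measurableSet.inter h.measurableSet

theorem Announcement.setIntegral_invited {F : Measure ℝ} [IsProbabilityMeasure F] {f : ℝ → ℝ}
    {x y z : ℝ} (hx : ∀ θ ∈ a.invitedWith (-1), f θ = x) (hy : ∀ θ ∈ a.invitedWith 0, f θ = y)
    (hz : ∀ θ ∈ a.invitedWith 1, f θ = z) :
    ∫ θ in a.invited, f θ ∂F = F.real (a.invitedWith (-1)) * x + F.real (a.invitedWith 0) * y +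
      F.real (a.invitedWith 1) * z := by
  have hA : a.invited = a.invitedWith (-1) ∪ a.invitedWith 0 ∪ a.invitedWith 1 := by
    ext θ
    constructor
    · intro h
      rcases a.q_mem θ (a.invited_subset h) with h1 | h1 | h1
      exacts [Or.inl (Or.inl ⟨h, h1⟩), Or.inl (Or.inr ⟨h, h1⟩), Or.inr ⟨h, h1⟩]
    · rintro ((h | h) | h) <;> exact h.1
  have hdis {j k : ℝ} (hjk : j ≠ k) : Disjoint (a.invitedWith j) (a.invitedWith k) :=
    Set.disjoint_left.2 fun θ h h' => hjk (h.2.symm.trans h'.2)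
  have hi {k c : ℝ} (h : ∀ θ ∈ a.invitedWith k, f θ = c) : IntegrableOn f (a.invitedWith k) F :=
    (integrableOn_const (by finiteness)).congr_fun (fun θ hθ => (h θ hθ).symm)
      measurableSet_invitedWith
  have hv {k c : ℝ} (h : ∀ θ ∈ a.invitedWith k, f θ = c) :
      ∫ θ in a.invitedWith k, f θ ∂F = F.real (a.invitedWith k) * c := by
    rw [setIntegral_congr_fun measurableSet_invitedWith h, setIntegral_const, smul_eq_mul]
  rw [hA, setIntegral_union ((hdis (by norm_num)).union_left (hdis (by norm_num)))
    measurableSet_invitedWith ((hi hx).union (hi hy)) (hi hz),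
    setIntegral_union (hdis (by norm_num)) measurableSet_invitedWith (hi hx) (hi hy), hv hx, hv hy,
    hv hz]

end Mechanism

/-! ### Consequences of the agents' choices -/

section Equilibrium

variable {F : Measure ℝ} {p : ℝ} {a : Announcement} {s : Profile}

/-- An active search market is a strictly positive outside option. This excludes every choice that
pays `0`: a marketplace that shut down, or staying out. -/
theorem IsContinuationEquilibrium.payoff_pos [IsProbabilityMeasure F]
    [NullSingletonClass F]
    (h : IsContinuationEquilibrium F p a s) (hp : 0 < p) (hD : 0 < F.real s.search) {θ : ℝ}
    (hθ : θ ∈ Icc (0 : ℝ) 1) : 0 < payoff F p a s θ :=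
  (searchPayoff_pos hp s.search_subset hD θ).trans_le (h.search_le θ hθ)

theorem IsContinuationEquilibrium.operates [IsProbabilityMeasure F]
    [NullSingletonClass F]
    (h : IsContinuationEquilibrium F p a s) (hp : 0 < p) (hD : 0 < F.real s.search)
    (hm : MarketplaceActive F s) : Operates a s := by
  by_contra hop
  have hne : s.market.Nonempty := by
    rw [nonempty_iff_ne_empty]
    intro h0
    simp [MarketplaceActive, h0] at hm
  obtain ⟨θ, hθ⟩ := hne
  have := h.payoff_pos hp hD (s.market_subset hθ)
  rw [payoff, if_pos hθ, marketPayoff, if_neg hop] at this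
  exact lt_irrefl _ this

theorem IsContinuationEquilibrium.searchPayoff_le_of_mem
    (h : IsContinuationEquilibrium F p a s) (hop : Operates a s) {θ : ℝ} (hθ : θ ∈ a.invited) :
    searchPayoff F p s.search θ ≤ θ * a.q θ - a.t θ := by
  have h1 := h.search_le θ (a.invited_subset hθ)
  rwa [payoff, if_pos (show θ ∈ s.market from hop ▸ hθ), marketPayoff, if_pos hop] at h1

theorem IsContinuationEquilibrium.mem_search_of_notMem [IsProbabilityMeasure F]
    [NullSingletonClass F]
    (h : IsContinuationEquilibrium F p a s) (hp : 0 < p) (hD : 0 < F.real s.search)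
    (hop : Operates a s) {θ : ℝ} (hθ : θ ∈ Icc (0 : ℝ) 1) (hA : θ ∉ a.invited) :
    θ ∈ s.search := by
  by_contra hs
  have := h.payoff_pos hp hD hθ
  rw [payoff, if_neg (show θ ∉ s.market from hop ▸ hA), if_neg hs] at this
  exact lt_irrefl _ this

theorem notMem_invited_of_mem_search (hop : Operates a s) {θ : ℝ} (hθ : θ ∈ s.search) :
    θ ∉ a.invited :=
  fun h => Set.disjoint_left.1 s.disjoint (hop ▸ h) hθ

theorem IsContinuationEquilibrium.le_searchPayoff_of_mem
    (h : IsContinuationEquilibrium F p a s) (hop : Operates a s) {θ : ℝ} (hθ : θ ∈ s.search) :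
    θ * a.q θ - a.t θ ≤ searchPayoff F p s.search θ := by
  have h1 := h.market_le θ (s.search_subset hθ)
  rwa [payoff, if_neg (fun hm => notMem_invited_of_mem_search hop hθ (hop ▸ hm)), if_pos hθ,
    marketPayoff, if_pos hop] at h1

/-- Types that sell in the marketplace form an initial segment: lower types gain more there. -/
theorem IsContinuationEquilibrium.seller_of_le [IsProbabilityMeasure F]
    [NullSingletonClass F]
    (h : IsContinuationEquilibrium F p a s) (hp : 0 < p) (hp1 : p ≤ 1)
    (hD : 0 < F.real s.search) (hop : Operates a s) {θ θ' : ℝ} (hθ : θ ∈ a.invitedWith (-1))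
    (h0 : 0 ≤ θ') (hle : θ' ≤ θ) : θ' ∈ a.invitedWith (-1) := by
  have hI := a.invited_subset hθ.1
  have hI' : θ' ∈ Icc (0 : ℝ) 1 := ⟨h0, hle.trans hI.2⟩
  have hq : a.q θ' = -1 := by
    have h1 := (a.q_mono hI' hI hle).trans hθ.2.le
    rcases a.q_mem θ' hI' with h2 | h2 | h2 <;> linarith
  have ht : a.t θ' = a.t θ := a.t_eq hI' hI (hq.trans hθ.2.symm)
  by_contra hn
  have hA : θ' ∉ a.invited := fun hA => hn ⟨hA, hq⟩
  -- If `θ'` searched, passing from `θ` down to `θ'` would raise the market payoff by `θ - θ'` and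
  -- the search payoff by at most half of that, forcing `θ = θ'`.
  have h1 := h.le_searchPayoff_of_mem hop (h.mem_search_of_notMem hp hD hop hI' hA)
  have h2 := h.searchPayoff_le_of_mem hop hθ.1
  have h3 := searchPayoff_lipschitz hp.le hp1 s.search_subset hD θ' θ
  rw [abs_of_nonpos (by linarith)] at h3
  rw [hq, ht] at h1
  rw [hθ.2] at h2
  exact hA ((show θ = θ' by linarith) ▸ hθ.1)

/-- Types that buy in the marketplace form a final segment: higher types gain more there. -/
theorem IsContinuationEquilibrium.buyer_of_le [IsProbabilityMeasure F]
    [NullSingletonClass F]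
    (h : IsContinuationEquilibrium F p a s) (hp : 0 < p) (hp1 : p ≤ 1)
    (hD : 0 < F.real s.search) (hop : Operates a s) {θ θ' : ℝ} (hθ : θ ∈ a.invitedWith 1)
    (h0 : θ' ≤ 1) (hle : θ ≤ θ') : θ' ∈ a.invitedWith 1 := by
  have hI := a.invited_subset hθ.1
  have hI' : θ' ∈ Icc (0 : ℝ) 1 := ⟨hI.1.trans hle, h0⟩
  have hq : a.q θ' = 1 := by
    have h1 := hθ.2.ge.trans (a.q_mono hI hI' hle)
    rcases a.q_mem θ' hI' with h2 | h2 | h2 <;> linarith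
  have ht : a.t θ' = a.t θ := a.t_eq hI' hI (hq.trans hθ.2.symm)
  by_contra hn
  have hA : θ' ∉ a.invited := fun hA => hn ⟨hA, hq⟩
  have h1 := h.le_searchPayoff_of_mem hop (h.mem_search_of_notMem hp hD hop hI' hA)
  have h2 := h.searchPayoff_le_of_mem hop hθ.1
  have h3 := searchPayoff_lipschitz hp.le hp1 s.search_subset hD θ' θ
  rw [abs_of_nonneg (by linarith)] at h3
  rw [hq, ht] at h1
  rw [hθ.2] at h2
  exact hA ((show θ = θ' by linarith) ▸ hθ.1)

/-- A profit-maximizing designer can always earn a positive profit. -/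
theorem IsEquilibrium.profit_pos [IsProbabilityMeasure F]
    [NullSingletonClass F]
    (hc : Continuous (ProbabilityTheory.cdf F)) (hF : F.support = Icc (0 : ℝ) 1) (hp0 : 0 ≤ p)
    (hp1 : p ≤ 1) (h : IsEquilibrium F p a s) : 0 < profit F a s := by
  have h0 : ProbabilityTheory.cdf F 0 = 0 := by
    rw [← measureReal_Icc_zero hF le_rfl, Icc_self, measureReal_def, measure_singleton]; rfl
  have h1 : ProbabilityTheory.cdf F 1 = 1 := by
    rw [← measureReal_Icc_zero hF zero_le_one, measureReal_unitInterval hF]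
  have ivt (c : ℝ) (hc' : c ∈ Icc (0 : ℝ) 1) : ∃ x ∈ Icc (0 : ℝ) 1, ProbabilityTheory.cdf F x = c :=
    intermediate_value_Icc zero_le_one hc.continuousOn (by rwa [h0, h1])
  -- Any equal tail masses would do; the quartiles leave `1/4` on each side.
  obtain ⟨l, hl, hlc⟩ := ivt (1 / 4) (by norm_num)
  obtain ⟨u, hu, huc⟩ := ivt (3 / 4) (by norm_num)
  have hlu : l < u := by
    by_contra! hle
    have := ProbabilityTheory.monotone_cdf F hle
    linarith
  obtain ⟨a', s', hf, hce, -, -, -, hprof⟩ := exists_interval_equilibrium hF hp0 hp1 hl.1 hlu hu.2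
    (by rw [measureReal_Icc_zero hF hl.1, measureReal_Icc_one hF hu.1 hu.2]; linarith)
  refine lt_of_lt_of_le ?_ (h.optimal a' s' hf hce)
  rw [hprof, measureReal_Icc_one hF hu.1 hu.2, huc]
  exact mul_pos (by norm_num) (mul_pos (by linarith) (by linarith))

end Equilibrium

end MarketChoice

/-! ### Cutoffs and the bound on profit -/

namespace MarketChoice

variable {F : Measure ℝ} [IsProbabilityMeasure F] {p : ℝ} {a : Announcement} {s : Profile}

/-- In an equilibrium with both markets active, the types in the marketplace that trade are those
below `l` and those above `u`, equally many, and almost no other type is invited. -/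
theorem IsEquilibrium.exists_cutoffs [NullSingletonClass F]
    (hc : Continuous (ProbabilityTheory.cdf F)) (hF : F.support = Icc (0 : ℝ) 1) (hp0 : 0 < p)
    (hp1 : p ≤ 1) (heq : IsEquilibrium F p a s) (hD : 0 < F.real s.search) (hop : Operates a s) :
    ∃ l u : ℝ, 0 ≤ l ∧ l < u ∧ u ≤ 1 ∧ s.search ⊆ Ioo l u ∧
      Ioo l u ∩ a.invited ⊆ a.invitedWith 0 ∧ F.real (a.invitedWith 0) = 0 ∧
      F.real (Icc 0 l) = F.real (Icc u 1) ∧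
      profit F a s ≤ F.real (Icc u 1) * ((1 - p / 2) * (u - l)) := by
  have hce := heq.continuation
  have hd0 (θ : ℝ) : 0 < searchPayoff F p s.search θ :=
    searchPayoff_pos hp0 s.search_subset hD θ
  have hum {θ : ℝ} (hθ : θ ∈ a.invited) := hce.searchPayoff_le_of_mem hop hθ
  -- `w` and `c` are payments to the designer, negative because sellers and non-traders must get
  -- more than `0`; `-w` is the price paid to sellers.
  obtain ⟨w, hw0, hw⟩ : ∃ w, w < 0 ∧ ∀ θ ∈ a.invitedWith (-1), a.t θ = w := by
    refine a.exists_t_eq (-1) ⟨-1, by norm_num⟩ fun θ hθ => ?_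
    have h1 := hum hθ.1
    rw [hθ.2] at h1
    linarith [hd0 θ, (a.invited_subset hθ.1).1]
  obtain ⟨c, hc0, hct⟩ : ∃ c, c < 0 ∧ ∀ θ ∈ a.invitedWith 0, a.t θ = c := by
    refine a.exists_t_eq 0 ⟨-1, by norm_num⟩ fun θ hθ => ?_
    have h1 := hum hθ.1
    rw [hθ.2] at h1
    linarith [hd0 θ]
  obtain ⟨v, -, hv⟩ : ∃ v, True ∧ ∀ θ ∈ a.invitedWith 1, a.t θ = v :=
    a.exists_t_eq 1 ⟨0, trivial⟩ fun _ _ => trivial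
  have hfeas : F.real (a.invitedWith 1) ≤ F.real (a.invitedWith (-1)) := by
    have h1 := heq.feasible
    rw [Announcement.Feasible, Announcement.setIntegral_invited (fun θ h => h.2) (fun θ h => h.2)
      (fun θ h => h.2)] at h1
    linarith
  have hprofit : profit F a s = F.real (a.invitedWith (-1)) * w + F.real (a.invitedWith 0) * c +
      F.real (a.invitedWith 1) * v := by
    rw [profit, if_pos hop, Announcement.setIntegral_invited hw hct hv]
  have hN0 : 0 ≤ F.real (a.invitedWith 0) := measureReal_nonneg
  -- Without buyers every payment that counts is negative, against `profit_pos`.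
  have hB0 : 0 < F.real (a.invitedWith 1) := by
    refine lt_of_le_of_ne measureReal_nonneg fun h0 => ?_
    have h1 := heq.profit_pos hc hF hp0.le hp1
    rw [hprofit, ← h0] at h1
    nlinarith [measureReal_nonneg (μ := F) (s := a.invitedWith (-1))]
  have hnonempty {k : ℝ} (h : 0 < F.real (a.invitedWith k)) : (a.invitedWith k).Nonempty := by
    rw [nonempty_iff_ne_empty]
    intro h0
    simp [h0] at h
  have hSne := hnonempty (hB0.trans_le hfeas)
  have hBne := hnonempty hB0
  have hI {k θ : ℝ} (h : θ ∈ a.invitedWith k) : θ ∈ Icc (0 : ℝ) 1 := a.invited_subset h.1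
  set l := sSup (a.invitedWith (-1)) with hl
  set u := sInf (a.invitedWith 1) with hu
  have hSbdd : BddAbove (a.invitedWith (-1)) := ⟨1, fun θ h => (hI h).2⟩
  have hBbdd : BddBelow (a.invitedWith 1) := ⟨0, fun θ h => (hI h).1⟩
  -- Closedness of the invited set puts the cutoffs in it, though their allocation is not determined
  -- here; hence the spread bound below is proved for pairs of actual traders and passed to the
  -- supremum and infimum.
  have hlA : l ∈ a.invited := closure_minimal (fun θ h => h.1) a.invited_closed
    (csSup_mem_closure hSne hSbdd)
  have huA : u ∈ a.invited := closure_minimal (fun θ h => h.1) a.invited_closed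
    (csInf_mem_closure hBne hBbdd)
  have hl01 := a.invited_subset hlA
  have hu01 := a.invited_subset huA
  have hltl {θ : ℝ} (h0 : 0 ≤ θ) (h : θ < l) : θ ∈ a.invitedWith (-1) := by
    obtain ⟨θ', h1, h2⟩ := exists_lt_of_lt_csSup hSne h
    exact hce.seller_of_le hp0 hp1 hD hop h1 h0 h2.le
  have hltu {θ : ℝ} (h0 : θ ≤ 1) (h : u < θ) : θ ∈ a.invitedWith 1 := by
    obtain ⟨θ', h1, h2⟩ := exists_lt_of_csInf_lt hBne h
    exact hce.buyer_of_le hp0 hp1 hD hop h1 h0 h2.le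
  have hsub : s.search ⊆ Ioo l u := by
    intro θ hθ
    have h01 := s.search_subset hθ
    have hA := notMem_invited_of_mem_search hop hθ
    constructor
    · by_contra! h
      rcases h.eq_or_lt with h | h
      exacts [hA (h ▸ hlA), hA (hltl h01.1 h).1]
    · by_contra! h
      rcases h.eq_or_lt with h | h
      exacts [hA (h ▸ huA), hA (hltu h01.2 h).1]
  have hlu : l < u := by
    have hne : s.search.Nonempty := by
      rw [nonempty_iff_ne_empty]
      intro h0
      simp [h0] at hD
    obtain ⟨θ, hθ⟩ := hne
    exact (hsub hθ).1.trans (hsub hθ).2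
  have hFS : F.real (a.invitedWith (-1)) = F.real (Icc 0 l) := by
    refine le_antisymm (measureReal_mono fun θ h => ⟨(hI h).1, le_csSup hSbdd h⟩) ?_
    rw [← measureReal_congr (Ico_ae_eq_Icc (μ := F) (a := 0) (b := l))]
    exact measureReal_mono fun θ h => hltl h.1 h.2
  have hFB : F.real (a.invitedWith 1) = F.real (Icc u 1) := by
    refine le_antisymm (measureReal_mono fun θ h => ⟨csInf_le hBbdd h, (hI h).2⟩) ?_
    rw [← measureReal_congr (Ioc_ae_eq_Icc (μ := F) (a := u) (b := 1))]
    exact measureReal_mono fun θ h => hltu h.2 h.1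
  have hk : 0 < 1 - p / 2 := by linarith
  have hvw : v + w ≤ (1 - p / 2) * (u - l) := by
    have h1 : ∀ x ∈ a.invitedWith (-1), ∀ y ∈ a.invitedWith 1,
        x + (v + w) / (1 - p / 2) ≤ y := by
      intro x hx y hy
      have h1 := hum hx.1
      have h2 := hum hy.1
      rw [hx.2, hw x hx] at h1
      rw [hy.2, hv y hy] at h2
      have h3 := le_searchPayoff_add (F := F) hp0.le s.search_subset hD x y
      have h4 : (v + w) / (1 - p / 2) ≤ y - x := by
        rw [div_le_iff₀ hk]
        linarith
      linarith
    have h2 : l ≤ u - (v + w) / (1 - p / 2) :=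
      csSup_le hSne fun x hx => le_sub_iff_add_le.2 (le_csInf hBne (h1 x hx))
    have h3 : (v + w) / (1 - p / 2) ≤ u - l := by linarith
    rw [div_le_iff₀ hk] at h3
    linarith
  -- Lowering `l` to `l'` drops the excess sellers and can only widen the gap. By optimality the
  -- interval announcement with cutoffs `l'`, `u` earns no more than the equilibrium profit, so all
  -- inequalities below are equalities.
  obtain ⟨l', hl', hcl'⟩ : ∃ l' ∈ Icc 0 l, ProbabilityTheory.cdf F l' = F.real (Icc u 1) := by
    refine intermediate_value_Icc hl01.1 hc.continuousOn ⟨?_, ?_⟩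
    · rw [← measureReal_Icc_zero hF le_rfl, Icc_self, measureReal_def, measure_singleton]
      exact measureReal_nonneg
    · rw [← measureReal_Icc_zero hF hl01.1, ← hFS, ← hFB]
      exact hfeas
  obtain ⟨a', s', hf', hce', -, -, -, hprof'⟩ := exists_interval_equilibrium hF hp0.le hp1 hl'.1
    (hl'.2.trans_lt hlu) hu01.2 (by rw [measureReal_Icc_zero hF hl'.1, hcl'])
  have hopt := heq.optimal a' s' hf' hce'
  rw [hprof', hprofit, ← hFB] at hopt
  have hle : F.real (a.invitedWith 1) * (v + w) ≤
      F.real (a.invitedWith 1) * ((1 - p / 2) * (u - l)) := by gcongr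
  have hle' : F.real (a.invitedWith 1) * ((1 - p / 2) * (u - l)) ≤
      F.real (a.invitedWith 1) * ((1 - p / 2) * (u - l')) := by
    have := hl'.2
    gcongr
  have h1 : (F.real (a.invitedWith (-1)) - F.real (a.invitedWith 1)) * w ≤ 0 :=
    mul_nonpos_of_nonneg_of_nonpos (sub_nonneg.2 hfeas) hw0.le
  have h2 : F.real (a.invitedWith 0) * c ≤ 0 := mul_nonpos_of_nonneg_of_nonpos hN0 hc0.le
  have h3 : F.real (a.invitedWith 0) = 0 :=
    (mul_eq_zero.1 (show F.real (a.invitedWith 0) * c = 0 by linarith)).resolve_right hc0.ne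
  have h4 : F.real (a.invitedWith (-1)) - F.real (a.invitedWith 1) = 0 :=
    (mul_eq_zero.1 (show (F.real (a.invitedWith (-1)) - F.real (a.invitedWith 1)) * w = 0 by
      linarith)).resolve_right hw0.ne
  refine ⟨l, u, hl01.1, hlu, hu01.2, hsub, ?_, h3, by rw [← hFS, ← hFB]; linarith, ?_⟩
  · rintro θ ⟨hθ, hA⟩
    rcases a.q_mem θ (a.invited_subset hA) with h | h | h
    · exact absurd (le_csSup hSbdd ⟨hA, h⟩) (not_le.2 hθ.1)
    · exact ⟨hA, h⟩
    · exact absurd (csInf_le hBbdd ⟨hA, h⟩) (not_le.2 hθ.2)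
  · rw [hprofit, ← hFB]
    linarith

end MarketChoice

/-! ### The interval structure of the search market -/

theorem mainTheorem4 (F : Measure ℝ) [IsProbabilityMeasure F]
    (hc : Continuous (ProbabilityTheory.cdf F))
    (hF : F.support = Icc (0 : ℝ) 1) (p : ℝ) (hp0 : 0 ≤ p) (hp1 : p ≤ 1)
    (a : MarketChoice.Announcement) (s : MarketChoice.Profile)
    (heq : MarketChoice.IsEquilibrium F p a s)
    (hm : MarketChoice.MarketplaceActive F s) (hs : MarketChoice.SearchActive F p s) :
    ∃ l u : ℝ, 0 ≤ l ∧ l < u ∧ u ≤ 1 ∧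
      -- the search market is the interval `(l, u)`, up to at most one type, which is indifferent
      s.search ⊆ Ioo l u ∧
      (Ioo l u \ s.search).Subsingleton ∧
      (∀ θ ∈ Ioo l u \ s.search,
        MarketChoice.marketPayoff a s θ = MarketChoice.searchPayoff F p s.search θ) ∧
      -- a simple equilibrium with the same cutoffs gives the designer the same profit
      ∃ (a' : MarketChoice.Announcement) (s' : MarketChoice.Profile),
        MarketChoice.IsEquilibrium F p a' s' ∧ s'.search = Ioo l u ∧
        s'.market = Icc 0 l ∪ Icc u 1 ∧ a'.invited = Icc 0 l ∪ Icc u 1 ∧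
        MarketChoice.profit F a' s' = MarketChoice.profit F a s := by
  open MarketChoice in
  have : NullSingletonClass F := nullSingletonClass_of_continuous_cdf hc
  have hp : 0 < p := by
    refine lt_of_le_of_ne hp0 fun h => ?_
    simp [SearchActive, ← h] at hs
  have hD : 0 < F.real s.search := pos_of_mul_pos_right hs (by positivity)
  have hce := heq.continuation
  have hop : Operates a s := hce.operates hp hD hm
  obtain ⟨l, u, hl, hlu, hu, hsub, hmid, hnull, hbal, hprof⟩ :=
    heq.exists_cutoffs hc hF hp hp1 hD hop
  have hA {θ : ℝ} (hθ : θ ∈ Ioo l u \ s.search) : θ ∈ a.invitedWith 0 := by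
    refine hmid ⟨hθ.1, ?_⟩
    by_contra h
    exact hθ.2 (hce.mem_search_of_notMem hp hD hop ⟨hl.trans hθ.1.1.le, hθ.1.2.le.trans hu⟩ h)
  -- Types of `(l, u)` that do not search are invited non-traders, a null set, so full support gives
  -- `D` mass on every subinterval.
  have hpos {x y : ℝ} (hx : l ≤ x) (hxy : x < y) (hy : y ≤ u) :
      0 < F.real (s.search ∩ Ioo x y) := by
    refine (measureReal_Ioo_pos hF (hl.trans hx) hxy (hy.trans hu)).trans_le ?_
    rw [← add_zero (F.real (s.search ∩ Ioo x y)), ← hnull]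
    refine (measureReal_mono fun θ hθ => ?_).trans (measureReal_union_le _ _)
    by_cases h : θ ∈ s.search
    · exact Or.inl ⟨h, hθ⟩
    · exact Or.inr (hA ⟨⟨hx.trans_lt hθ.1, hθ.2.trans_le hy⟩, h⟩)
  have hne {x y : ℝ} (hx : l ≤ x) (hxy : x < y) (hy : y ≤ u) : (s.search ∩ Ioo x y).Nonempty := by
    rw [nonempty_iff_ne_empty]
    intro h0
    have := hpos hx hxy hy
    simp [h0] at this
  refine ⟨l, u, hl, hlu, hu, hsub, ?_, ?_, ?_⟩
  · suffices key : ∀ x ∈ Ioo l u \ s.search, ∀ y ∈ Ioo l u \ s.search, ¬ x < y from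
      fun x hx y hy => le_antisymm (not_lt.1 (key y hy x hx)) (not_lt.1 (key x hx y hy))
    intro x hx y hy hxy
    obtain ⟨z, hzD, hz⟩ := hne hx.1.1.le hxy hy.1.2.le
    have hxA := hA hx
    have hyA := hA hy
    have hxI := a.invited_subset hxA.1
    have hyI := a.invited_subset hyA.1
    have hzI := s.search_subset hzD
    -- Monotonicity of `q` squeezes `q z` to `0`, so `z` would get the same market payoff as `x` and
    -- `y`.
    have hqz : a.q z = 0 := le_antisymm ((a.q_mono hzI hyI hz.2.le).trans hyA.2.le)
      (hxA.2.ge.trans (a.q_mono hxI hzI hz.1.le))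
    have htx := a.t_eq hxI hzI (hxA.2.trans hqz.symm)
    have hty := a.t_eq hyI hzI (hyA.2.trans hqz.symm)
    have h1 := hce.searchPayoff_le_of_mem hop hxA.1
    have h2 := hce.searchPayoff_le_of_mem hop hyA.1
    have h3 := hce.le_searchPayoff_of_mem hop hzD
    rw [hxA.2, htx, mul_zero, zero_sub] at h1
    rw [hyA.2, hty, mul_zero, zero_sub] at h2
    rw [hqz, mul_zero, zero_sub] at h3
    exact absurd (searchPayoff_lt_of_mem_Ioo hp s.search_subset
      (hpos hx.1.1.le hxy hy.1.2.le) hz h1 h2) (not_lt.2 h3)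
  · intro θ hθ
    have hθA := hA hθ
    have hθI := a.invited_subset hθA.1
    rw [marketPayoff, if_pos hop]
    -- A searching type `z` just above `θ` could report `θ` for the same constant payoff, yet it
    -- searches; continuity of the search payoff carries the inequality back to `θ`.
    refine le_antisymm (le_of_forall_pos_le_add fun ε hε => ?_)
      (hce.searchPayoff_le_of_mem hop hθA.1)
    obtain ⟨z, hzD, hz⟩ := hne hθ.1.1.le (show θ < min u (θ + ε / 2) from
      lt_min hθ.1.2 (by linarith)) (min_le_left _ _)
    have hzI := s.search_subset hzD
    have hzε := hz.2.trans_le (min_le_right _ _)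
    have h1 := hce.le_searchPayoff_of_mem hop hzD
    have h2 := a.incentive_compatible z hzI θ hθI
    have h3 := searchPayoff_lipschitz hp0 hp1 s.search_subset hD z θ
    rw [abs_of_pos (sub_pos.2 hz.1)] at h3
    rw [hθA.2] at h2 ⊢
    linarith
  · obtain ⟨a', s', hf', hce', h1, h2, h3, hprof'⟩ :=
      exists_interval_equilibrium hF hp0 hp1 hl hlu hu hbal
    have hsame : profit F a' s' = profit F a s :=
      le_antisymm (heq.optimal a' s' hf' hce') (hprof.trans hprof'.ge)
    exact ⟨a', s', ⟨hf', hce', fun b r hb hr => hsame ▸ heq.optimal b r hb hr⟩, h1, h2, h3, hsame⟩
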